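/- **Theorem (Higher-order equational logic).** Fix a family $V=(V_i)_{i\ge 1}$ of sets of variables (possibly all empty). *Signatures.* A signature $\Sigma=\bigcup_{i=0}^{n}\langle C_i,F_i,P_i\rangle$ consists of $n\in\mathbb N$ and, for each order $i\le n$, countable sets of constant symbols $C_i$, function symbols $F_i$ and predicate symbols $P_i$, with $C_0=F_0=\emptyset$. Each function or predicate symbol $f$ has an arity $\mathrm{ar}(f)$ and, for each argument place $j$, an order $\mathrm{order}(f,j)\in\{1,\dots,n\}$; symbols in $P_0$ have arity $0$. A morphism $\Sigma\to\Sigma'$ exists only if $n\le n'$ and consists of total functions $C_i\to C_i'$, $F_i\to F_i'$, $P_i\to P_i'$ preserving arities and the orders of arguments. Let $\mathsf{Sign}$ be the category of these signatures, or any full subcategory of it (for example the one where all arguments of a symbol of order $i$ have order $<i$). *Sentences.* Terms of order $i$ over $\Sigma$ are generated by the variables in $V_i$ ($1\le i\le n$), the constants in $C_i$, and $f(t_1,\dots,t_k)$ with $f\in F_i$ and $t_j$ a term of order $\mathrm{order}(f,j)$. $\mathbf{Sen}(\Sigma)$ is the set of all equations $t=t'$ between terms of the same order and all atoms $P(t_1,\dots,t_k)$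 with $t_j$ a term of order $\mathrm{order}(P,j)$. Morphisms act on sentences by renaming symbols and fixing variables. *Models.* For a set $S$ let $V^0(S)=\emptyset$, $V^1(S)=S$, $V^{m+1}(S)=V^m(S)\cup\mathcal P(V^m(S))$ for $m\ge 1$, $S^\#=\bigcup_m V^m(S)$ and $V^{[\![i]\!]}(S)=V^i(S)\setminus V^{i-1}(S)$. A model of $\Sigma$ is given by a set $S$ for which $(S^\#,\in)$ satisfies the extensionality axiom, an element of $V^{[\![i]\!]}(S)$ for each $c\in C_i$, a function $V^{[\![\mathrm{order}(f,1)]\!]}(S)\times\dots\times V^{[\![\mathrm{order}(f,\mathrm{ar}(f))]\!]}(S)\to V^{[\![i]\!]}(S)$ for each $f\in F_i$, a subset of $V^{[\![\mathrm{order}(p,1)]\!]}(S)\times\dots\times V^{[\![\mathrm{order}(p,\mathrm{ar}(p))]\!]}(S)$ for each predicate symbol $p$ (so a truth value for $p\in P_0$), and maps $V_i\to V^{[\![i]\!]}(S)$ for $1\le i\le n$. Homomorphisms of models over $S$ and $S'$ are the maps $S^\#\to S'^\#$ that send each $V^{[\![i]\!]}(S)$ ($i\ge 1$) into $V^{[\![i]\!]}(S')$,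 commute with the interpretations of constants, function symbols and variables, and preserve the predicates. $\mathbf{Mod}(\Sigma)$ is the category of models, and $\mathbf{Mod}(\sigma)$ is the reduct along $\sigma$. $\mathcal M\models_\Sigma\varphi$ is the usual evaluation of equations and atoms in $\mathcal M$. *Calculus.* $\Gamma\vdash_\Sigma\varphi$, for $\Gamma\cup\{\varphi\}\subseteq\mathbf{Sen}(\Sigma)$, means that there is a well-founded, possibly infinitely branching, proof tree of $\varphi$ from $\Gamma$. The formulae in the tree are sentences and auxiliary equations $f=f'$ between function symbols of the same order, arity and argument orders; the latter are not sentences. The rules are: [Ref], [Sym], [Trans] for equations between terms of the same order and for equations between function symbols; [Ax]: infer any member of $\Gamma$; [Ext]: infer $f=f'$ from all equations $f(\bar t)=f'(\bar t)$, where $\bar t$ ranges over all tuples of terms of the orders of the arguments; [Func]: from $f=f'$ and $t_j=t_j'$ for all $j$ infer $f(t_1,\dots,t_k)=f'(t_1',\dots,t_k')$, and, for a predicate symbol $P$, from $t_j=t'_j$ for all $j$ and $P(t_1,\dots,t_k)$ infer $P(t'_1,\dots,t'_k)$. Then: 1. $\langle\mathsf{Sign},\mathbf{Sen},\mathbf{Mod},\{\models_\Sigma\}\rangle$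 is an institution: for all $\sigma:\Sigma\to\Sigma'$, $\varphi\in\mathbf{Sen}(\Sigma)$ and $\mathcal M'\in\mathbf{Mod}(\Sigma')$, $\mathcal M'\models_{\Sigma'}\mathbf{Sen}(\sigma)(\varphi)$ if and only if $\mathbf{Mod}(\sigma)(\mathcal M')\models_\Sigma\varphi$. 2. $\langle\mathsf{Sign},\mathbf{Sen},\{\vdash_\Sigma\}\rangle$ is an entailment system: $\{\varphi\}\vdash_\Sigma\varphi$; $\Gamma\vdash_\Sigma\varphi$ and $\Gamma\subseteq\Gamma'$ imply $\Gamma'\vdash_\Sigma\varphi$; if $\Gamma\vdash_\Sigma\psi$ for all $\psi\in\Delta$ and $\Delta\vdash_\Sigma\varphi$, then $\Gamma\vdash_\Sigma\varphi$; and $\Gamma\vdash_\Sigma\varphi$ implies $\mathbf{Sen}(\sigma)(\Gamma)\vdash_{\Sigma'}\mathbf{Sen}(\sigma)(\varphi)$ for every $\sigma:\Sigma\to\Sigma'$. 3. $\langle\mathsf{Sign},\mathbf{Sen},\mathbf{Mod},\{\vdash_\Sigma\},\{\models_\Sigma\}\rangle$ is a sound and complete logic: in addition to 1 and 2, for every signature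 $\Sigma$ and $\Gamma\cup\{\varphi\}\subseteq\mathbf{Sen}(\Sigma)$, $\Gamma\vdash_\Sigma\varphi$ if and only if every $\Sigma$-model of $\Gamma$ satisfies $\varphi$. -/

import Mathlib

open CategoryTheory Opposite

universe u

/-! ### Institutions, entailment systems, and logics -/

/-- `⟨Sign, Sen, Mod, ⊨⟩` is an institution: on top of the two functors and the family of relations,
truth is invariant under change of notation. -/
structure IsInstitution {Sign : Type*} [Category Sign] (Sen : Sign ⥤ Type*) (Mod : Signᵒᵖ ⥤ Cat)
    (Sat : ∀ A : Sign, Mod.obj (op A) → Sen.obj A → Prop) : Prop where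
  invariance : ∀ {A B : Sign} (σ : A ⟶ B) (φ : Sen.obj A) (M : Mod.obj (op B)),
    Sat B M (Sen.map σ φ) ↔ Sat A ((Mod.map σ.op).toFunctor.obj M) φ

/-- `⟨Sign, Sen, ⊢⟩` is an entailment system. -/
structure IsEntailmentSystem {Sign : Type*} [Category Sign] (Sen : Sign ⥤ Type*)
    (Ent : ∀ A : Sign, Set (Sen.obj A) → Sen.obj A → Prop) : Prop where
  refl : ∀ (A : Sign) (φ : Sen.obj A), Ent A {φ} φ
  mono : ∀ (A : Sign) (Γ Γ' : Set (Sen.obj A)) (φ : Sen.obj A),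
    Ent A Γ φ → Γ ⊆ Γ' → Ent A Γ' φ
  trans : ∀ (A : Sign) (Γ Δ : Set (Sen.obj A)) (φ : Sen.obj A),
    (∀ ψ ∈ Δ, Ent A Γ ψ) → Ent A Δ φ → Ent A Γ φ
  translation : ∀ {A B : Sign} (σ : A ⟶ B) (Γ : Set (Sen.obj A)) (φ : Sen.obj A),
    Ent A Γ φ → Ent B ((fun ψ => Sen.map σ ψ) '' Γ) (Sen.map σ φ)

/-- The semantic consequence relation `Γ ⊨ φ` induced by a satisfaction relation. -/
def SemConseq {M S : Type*} (Sat : M → S → Prop) (Γ : Set S) (φ : S) : Prop :=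
  ∀ m : M, (∀ γ ∈ Γ, Sat m γ) → Sat m φ

/-- `⟨Sign, Sen, Mod, ⊢, ⊨⟩` is a (sound) logic. -/
structure IsLogic {Sign : Type*} [Category Sign] (Sen : Sign ⥤ Type*) (Mod : Signᵒᵖ ⥤ Cat)
    (Ent : ∀ A : Sign, Set (Sen.obj A) → Sen.obj A → Prop)
    (Sat : ∀ A : Sign, Mod.obj (op A) → Sen.obj A → Prop) : Prop where
  entailmentSystem : IsEntailmentSystem Sen Ent
  institution : IsInstitution Sen Mod Sat
  sound : ∀ (A : Sign) (Γ : Set (Sen.obj A)) (φ : Sen.obj A),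
    Ent A Γ φ → SemConseq (Sat A) Γ φ

/-- `⟨Sign, Sen, Mod, ⊢, ⊨⟩` is a complete logic. -/
structure IsCompleteLogic {Sign : Type*} [Category Sign] (Sen : Sign ⥤ Type*) (Mod : Signᵒᵖ ⥤ Cat)
    (Ent : ∀ A : Sign, Set (Sen.obj A) → Sen.obj A → Prop)
    (Sat : ∀ A : Sign, Mod.obj (op A) → Sen.obj A → Prop) : Prop where
  logic : IsLogic Sen Mod Ent Sat
  complete : ∀ (A : Sign) (Γ : Set (Sen.obj A)) (φ : Sen.obj A),
    SemConseq (Sat A) Γ φ → Ent A Γ φ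

namespace HOEq

/-! ### Signatures -/

/-- A signature `⋃_{i ≤ n} ⟨C_i, F_i, P_i⟩`. The family `F w i` collects the function symbols
`f ∈ F_i` with `ar f = w.length` and `order (f, j) = w_j`, and likewise for predicate symbols.
In order `0` there are only propositional symbols. -/
structure Signature : Type (u + 1) where
  n : ℕ
  C : ℕ → Type u
  F : List ℕ → ℕ → Type u
  P : List ℕ → ℕ → Type u
  countable_C : ∀ i, Countable (C i)
  countable_F : ∀ w i, Countable (F w i)
  countable_P : ∀ w i, Countable (P w i)
  bound_C : ∀ {i}, C i → 1 ≤ i ∧ i ≤ n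
  bound_F : ∀ {w i}, F w i → (1 ≤ i ∧ i ≤ n) ∧ ∀ k ∈ w, 1 ≤ k ∧ k ≤ n
  bound_P : ∀ {w i}, P w i → (i ≤ n ∧ (i = 0 → w = [])) ∧ ∀ k ∈ w, 1 ≤ k ∧ k ≤ n

/-- A signature morphism: `n ≤ n'`, and total functions on symbols of each order
(preserving arities and the orders of arguments). -/
@[ext]
structure SigHom (A B : Signature.{u}) : Type u where
  le : A.n ≤ B.n
  onC : ∀ i, A.C i → B.C i
  onF : ∀ w i, A.F w i → B.F w i
  onP : ∀ w i, A.P w i → B.P w i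

instance : Category.{u} Signature.{u} where
  Hom := SigHom
  id A := ⟨le_rfl, fun _ c => c, fun _ _ f => f, fun _ _ p => p⟩
  comp σ τ := ⟨σ.le.trans τ.le, fun i c => τ.onC i (σ.onC i c),
    fun w i f => τ.onF w i (σ.onF w i f), fun w i p => τ.onP w i (σ.onP w i p)⟩

/-! ### Terms and sentences over a family `V` of sets of variables -/

/-- The variables of order `i` that are available over the signature `A`,
namely those in `V i` when `1 ≤ i ≤ n`. -/
def Var (V : ℕ → Type u) (A : Signature.{u}) (i : ℕ) : Type u :=
  {_x : V i // 1 ≤ i ∧ i ≤ A.n}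

/-- `Term V A i` is the set of terms of order `i`. -/
inductive Term (V : ℕ → Type u) (A : Signature.{u}) : ℕ → Type u
  | var {i : ℕ} (x : Var V A i) : Term V A i
  | cst {i : ℕ} (c : A.C i) : Term V A i
  | app {w : List ℕ} {i : ℕ} (f : A.F w i) (ts : ∀ j : Fin w.length, Term V A (w.get j)) :
      Term V A i

/-- Sentences: equations between terms of the same order, and predicates applied to terms. -/
inductive Sentence (V : ℕ → Type u) (A : Signature.{u}) : Type u
  | eq {i : ℕ} (t t' : Term V A i) : Sentence V A
  | pred {w : List ℕ} {i : ℕ} (p : A.P w i) (ts : ∀ j : Fin w.length, Term V A (w.get j)) :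
      Sentence V A

variable {V : ℕ → Type u}

/-- The translation of variables along a morphism is the identity on `V`. -/
def Var.map {A B : Signature.{u}} (σ : A ⟶ B) {i : ℕ} (x : Var V A i) : Var V B i :=
  ⟨x.1, x.2.1, x.2.2.trans (SigHom.le σ)⟩

/-- The translation `σ*` of terms. -/
def Term.map {A B : Signature.{u}} (σ : A ⟶ B) : ∀ {i : ℕ}, Term V A i → Term V B i
  | _, .var x => .var (x.map σ)
  | _, .cst c => .cst (SigHom.onC σ _ c)
  | _, .app f ts => .app (SigHom.onF σ _ _ f) fun j => (ts j).map σ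

/-- The translation of sentences. -/
def Sentence.map {A B : Signature.{u}} (σ : A ⟶ B) : Sentence V A → Sentence V B
  | .eq t t' => .eq (t.map σ) (t'.map σ)
  | .pred p ts => .pred (SigHom.onP σ _ _ p) fun j => (ts j).map σ

theorem Term.map_id {A : Signature.{u}} {i : ℕ} (t : Term V A i) : t.map (𝟙 A) = t := by
  induction t with
  | var x => rfl
  | cst c => rfl
  | app f ts ih =>
    simp only [Term.map]
    exact congrArg (Term.app f) (funext ih)

theorem Term.map_comp {A B D : Signature.{u}} (σ : A ⟶ B) (τ : B ⟶ D) {i : ℕ} (t : Term V A i) :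
    t.map (σ ≫ τ) = (t.map σ).map τ := by
  induction t with
  | var x => rfl
  | cst c => rfl
  | app f ts ih =>
    simp only [Term.map]
    exact congrArg (Term.app _) (funext ih)

theorem Sentence.map_id {A : Signature.{u}} (φ : Sentence V A) : φ.map (𝟙 A) = φ := by
  cases φ with
  | eq t t' => simp only [Sentence.map, Term.map_id]
  | pred p ts =>
    simp only [Sentence.map, Term.map_id]
    rfl

theorem Sentence.map_comp {A B D : Signature.{u}} (σ : A ⟶ B) (τ : B ⟶ D) (φ : Sentence V A) :
    φ.map (σ ≫ τ) = (φ.map σ).map τ := by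
  cases φ with
  | eq t t' => simp only [Sentence.map, Term.map_comp]
  | pred p ts =>
    simp only [Sentence.map, Term.map_comp]
    rfl

/-- The functor of sentences. -/
def Sen (V : ℕ → Type u) : Signature.{u} ⥤ Type u where
  obj A := Sentence V A
  map σ := TypeCat.ofHom (Sentence.map σ)
  map_id A := by
    ext φ
    exact Sentence.map_id φ
  map_comp σ τ := by
    ext φ
    exact Sentence.map_comp σ τ φ

/-! ### The superstructure over a set, and models -/

/-- `V^0(S) = ∅`, `V^1(S) = S`, `V^{m+1}(S) = V^m(S) ∪ 𝒫(V^m(S))`. -/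
noncomputable def superLevel (S : ZFSet.{u}) : ℕ → ZFSet.{u}
  | 0 => ∅
  | 1 => S
  | m + 2 => superLevel S (m + 1) ∪ (superLevel S (m + 1)).powerset

/-- `V^{[[i]]}(S) = V^i(S) \ V^{i-1}(S)`, the objects of order `i` (used for `1 ≤ i`). -/
def Layer (S : ZFSet.{u}) (i : ℕ) : Type (u + 1) :=
  {x : ZFSet.{u} // x ∈ superLevel S i \ superLevel S (i - 1)}

/-- The superstructure `S^# = ⋃_m V^m(S)`. -/
def superstructure (S : ZFSet.{u}) : Set ZFSet.{u} :=
  {x | ∃ m, x ∈ superLevel S m}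

/-- The extensionality axiom, evaluated in the domain `S^#`. -/
def IsExtensional (S : ZFSet.{u}) : Prop :=
  ∀ x ∈ superstructure S, ∀ x' ∈ superstructure S,
    (∀ y ∈ superstructure S, y ∈ x ↔ y ∈ x') → x = x'

/-- An interpretation of a signature over the superstructure of a set. The interpretation of a
predicate is a set of argument tuples; for a propositional symbol there is only the empty tuple,
so that this is a truth value. -/
structure Interpretation (A : Signature.{u}) : Type (u + 1) where
  S : ZFSet.{u}
  cst : ∀ {i}, A.C i → Layer S i
  fn : ∀ {w i}, A.F w i → (∀ j : Fin w.length, Layer S (w.get j)) → Layer S i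
  pr : ∀ {w i}, A.P w i → Set (∀ j : Fin w.length, Layer S (w.get j))

/-- An (extensional) model: an extensional interpretation and an assignment of the variables. -/
structure Model (V : ℕ → Type u) (A : Signature.{u}) : Type (u + 1) where
  toInterp : Interpretation A
  ext : IsExtensional toInterp.S
  asg : ∀ {i}, Var V A i → Layer toInterp.S i

/-- Homomorphisms of models: maps between the superstructures that preserve the order of objects,
the interpretations of all symbols, and the assignment. -/
@[ext]
structure ModelHom {A : Signature.{u}} (M N : Model V A) : Type (u + 1) where
  toFun : ∀ i, Layer M.toInterp.S i → Layer N.toInterp.S i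
  map_cst : ∀ {i} (c : A.C i), toFun i (M.toInterp.cst c) = N.toInterp.cst c
  map_fn : ∀ {w i} (f : A.F w i) (a : ∀ j : Fin w.length, Layer M.toInterp.S (w.get j)),
    toFun i (M.toInterp.fn f a) = N.toInterp.fn f fun j => toFun _ (a j)
  map_pr : ∀ {w i} (p : A.P w i) (a : ∀ j : Fin w.length, Layer M.toInterp.S (w.get j)),
    a ∈ M.toInterp.pr p → (fun j => toFun _ (a j)) ∈ N.toInterp.pr p
  map_asg : ∀ {i} (x : Var V A i), toFun i (M.asg x) = N.asg x

instance {A : Signature.{u}} : Category.{u + 1} (Model V A) where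
  Hom := ModelHom
  id M := ⟨fun _ a => a, fun _ => rfl, fun _ _ => rfl, fun _ _ h => h, fun _ => rfl⟩
  comp g h :=
    { toFun := fun i a => h.toFun i (g.toFun i a)
      map_cst := fun c => by rw [g.map_cst, h.map_cst]
      map_fn := fun f a => by rw [g.map_fn, h.map_fn]
      map_pr := fun p a ha => h.map_pr p _ (g.map_pr p a ha)
      map_asg := fun x => by rw [g.map_asg, h.map_asg] }

/-- The reduct of a model along a signature morphism. -/
def Model.reduct {A B : Signature.{u}} (σ : A ⟶ B) (M : Model V B) : Model V A where
  toInterp :=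
    { S := M.toInterp.S
      cst := fun c => M.toInterp.cst (SigHom.onC σ _ c)
      fn := fun f => M.toInterp.fn (SigHom.onF σ _ _ f)
      pr := fun p => M.toInterp.pr (SigHom.onP σ _ _ p) }
  ext := M.ext
  asg := fun x => M.asg (x.map σ)

/-- The reduct functor. -/
def reductFunctor {A B : Signature.{u}} (σ : A ⟶ B) : Model V B ⥤ Model V A where
  obj M := M.reduct σ
  map {M N} h :=
    ({ toFun := (show ModelHom M N from h).toFun
       map_cst := fun _ => (show ModelHom M N from h).map_cst _
       map_fn := fun _ a => (show ModelHom M N from h).map_fn _ a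
       map_pr := fun _ a ha => (show ModelHom M N from h).map_pr _ a ha
       map_asg := fun _ => (show ModelHom M N from h).map_asg _ } :
      ModelHom (M.reduct σ) (N.reduct σ))
  map_id _ := rfl
  map_comp _ _ := rfl

/-- The functor of models. -/
def Mod (V : ℕ → Type u) : Signature.{u}ᵒᵖ ⥤ Cat.{u + 1, u + 1} where
  obj A := Cat.of (Model V A.unop)
  map σ := (reductFunctor σ.unop).toCatHom
  map_id _ := rfl
  map_comp _ _ := rfl

/-! ### Satisfaction -/

/-- The value of a term in a model. -/
def Model.val {A : Signature.{u}} (M : Model V A) :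
    ∀ {i : ℕ}, Term V A i → Layer M.toInterp.S i
  | _, .var x => M.asg x
  | _, .cst c => M.toInterp.cst c
  | _, .app f ts => M.toInterp.fn f fun j => M.val (ts j)

/-- The satisfaction relation. -/
def Model.Sat {A : Signature.{u}} (M : Model V A) : Sentence V A → Prop
  | .eq t t' => M.val t = M.val t'
  | .pred p ts => (fun j => M.val (ts j)) ∈ M.toInterp.pr p

/-- The satisfaction relations, indexed by signatures. -/
def Sat (V : ℕ → Type u) (A : Signature.{u}) (M : (Mod V).obj (op A)) (φ : (Sen V).obj A) : Prop :=
  Model.Sat (show Model V A from M) φ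

/-! ### The calculus -/

/-- The formulae that may occur in a proof tree: sentences, and equations between function symbols
with the same profile, which are the conclusions of the extensionality rule. -/
inductive Formula (V : ℕ → Type u) (A : Signature.{u}) : Type u
  | sen (φ : Sentence V A) : Formula V A
  | fnEq {w : List ℕ} {i : ℕ} (f f' : A.F w i) : Formula V A

/-- An equation between terms, as a formula. -/
def Formula.eq {A : Signature.{u}} {i : ℕ} (t t' : Term V A i) : Formula V A :=
  .sen (.eq t t')

/-- Existence of a (well-founded, possibly infinitely branching) proof tree from `Γ`. -/
inductive Derivable {A : Signature.{u}} (Γ : Set (Sentence V A)) : Formula V A → Prop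
  | ref {i : ℕ} (t : Term V A i) : Derivable Γ (.eq t t)
  | sym {i : ℕ} {t t' : Term V A i} : Derivable Γ (.eq t t') → Derivable Γ (.eq t' t)
  | trans {i : ℕ} {t t' t'' : Term V A i} :
      Derivable Γ (.eq t t') → Derivable Γ (.eq t' t'') → Derivable Γ (.eq t t'')
  | refFn {w : List ℕ} {i : ℕ} (f : A.F w i) : Derivable Γ (.fnEq f f)
  | symFn {w : List ℕ} {i : ℕ} {f f' : A.F w i} :
      Derivable Γ (.fnEq f f') → Derivable Γ (.fnEq f' f)
  | transFn {w : List ℕ} {i : ℕ} {f f' f'' : A.F w i} :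
      Derivable Γ (.fnEq f f') → Derivable Γ (.fnEq f' f'') → Derivable Γ (.fnEq f f'')
  | ax {φ : Sentence V A} : φ ∈ Γ → Derivable Γ (.sen φ)
  | ext {w : List ℕ} {i : ℕ} {f f' : A.F w i} :
      (∀ ts : ∀ j : Fin w.length, Term V A (w.get j), Derivable Γ (.eq (.app f ts) (.app f' ts))) →
      Derivable Γ (.fnEq f f')
  | func {w : List ℕ} {i : ℕ} {f f' : A.F w i} {ts ts' : ∀ j : Fin w.length, Term V A (w.get j)} :
      Derivable Γ (.fnEq f f') → (∀ j, Derivable Γ (.eq (ts j) (ts' j))) →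
      Derivable Γ (.eq (.app f ts) (.app f' ts'))
  | funcPred {w : List ℕ} {i : ℕ} {p : A.P w i}
      {ts ts' : ∀ j : Fin w.length, Term V A (w.get j)} :
      (∀ j, Derivable Γ (.eq (ts j) (ts' j))) → Derivable Γ (.sen (.pred p ts)) →
      Derivable Γ (.sen (.pred p ts'))

/-- The entailment relations `Γ ⊢ φ` between sets of sentences and sentences, indexed by
signatures. -/
def Ent (V : ℕ → Type u) (A : Signature.{u}) (Γ : Set ((Sen V).obj A)) (φ : (Sen V).obj A) : Prop :=
  Derivable (show Set (Sentence V A) from Γ) (.sen φ)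

end HOEq

/-!
Satisfaction is invariant under change of notation because the value of a translated term in a
model is the value of the term in the reduct. The entailment system laws and soundness are
inductions on proof trees. For translation along morphisms and for soundness, the auxiliary
equations `f = f'` between function symbols need care: the target signature may have further terms,
and a model may have objects that no term denotes, so `f = f'` cannot be read as an equality of
functions. It is read as the family of all equations `f(t) = f'(t)` over the terms `t` of the given
signature; the rule [Ext] has exactly these as premises, and they are all that [Func] needs. This
gives both soundness (`Derivable.holds`) and stability under signature morphisms
(`Derivable.translates`).

For completeness, the terms of each order, modulo provable equality from `Γ`, are embedded in the
objects of that order of a single superstructure, and function and predicate symbols are interpreted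
by what `Γ` proves about the terms (`codedModel`). The value of a term is then its own code, so the
model satisfies precisely the sentences derivable from `Γ` (`codedModel_sat`). Function values at
tuples that are not codes of terms are irrelevant, and are chosen arbitrarily.

The embedding exists since `S = V_ o` for a large limit ordinal `o` has an extensional
superstructure with levels `V_ (o + m)`, and, for `s ∈ S`, the sets `V_ (o + m) \ {s}` are distinct
objects of order `m + 2` (`exists_isExtensional_forall_injective_layer`).
-/

namespace HOEq

variable {V : ℕ → Type u} {A B : Signature.{u}}

/-! ### Invariance of satisfaction under translation -/

theorem Model.val_map (σ : A ⟶ B) (M : Model V B) {i : ℕ} (t : Term V A i) :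
    M.val (t.map σ) = (M.reduct σ).val t := by
  induction t with
  | var x => rfl
  | cst c => rfl
  | app f ts ih => exact congrArg (M.toInterp.fn (SigHom.onF σ _ _ f)) (funext ih)

theorem Model.sat_map (σ : A ⟶ B) (M : Model V B) (φ : Sentence V A) :
    M.Sat (φ.map σ) ↔ (M.reduct σ).Sat φ := by
  cases φ with
  | eq t t' =>
    simp only [Sentence.map, Model.Sat, Model.val_map]
    rfl
  | pred p ts =>
    simp only [Sentence.map, Model.Sat, Model.val_map]
    rfl

/-! ### Structural properties of derivability -/

theorem Derivable.cut {Γ Δ : Set (Sentence V A)} {ψ : Formula V A}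
    (hΔ : ∀ φ ∈ Δ, Derivable Γ (.sen φ)) (h : Derivable Δ ψ) : Derivable Γ ψ := by
  induction h with
  | ref t => exact .ref t
  | sym _ ih => exact .sym ih
  | trans _ _ ih ih' => exact .trans ih ih'
  | refFn f => exact .refFn f
  | symFn _ ih => exact .symFn ih
  | transFn _ _ ih ih' => exact .transFn ih ih'
  | ax hφ => exact hΔ _ hφ
  | ext _ ih => exact .ext ih
  | func _ _ ih ih' => exact .func ih ih'
  | funcPred _ _ ih ih' => exact .funcPred ih ih'

theorem Derivable.mono {Γ Γ' : Set (Sentence V A)} {ψ : Formula V A} (hΓ : Γ ⊆ Γ')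
    (h : Derivable Γ ψ) : Derivable Γ' ψ :=
  h.cut fun _ hφ => .ax (hΓ hφ)

/-- The translation of a formula along `σ` is derivable from `Γ`, where an equation between function
symbols is read as the equations between their values at the translations of `A`-terms. The stronger
reading `Derivable Γ (.fnEq (σ f) (σ f'))` is not preserved by [Ext], as `B` may have new terms. -/
def Formula.Translates (σ : A ⟶ B) (Γ : Set (Sentence V B)) : Formula V A → Prop
  | .sen φ => Derivable Γ (.sen (φ.map σ))
  | @Formula.fnEq _ _ w _ f f' => ∀ ts : ∀ j : Fin w.length, Term V A (w.get j),
      Derivable Γ (.eq ((Term.app f ts).map σ) ((Term.app f' ts).map σ))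

theorem Derivable.translates (σ : A ⟶ B) {Γ : Set (Sentence V A)} {ψ : Formula V A}
    (h : Derivable Γ ψ) : ψ.Translates σ (Sentence.map σ '' Γ) := by
  induction h with
  | ref t => exact .ref _
  | sym _ ih => exact .sym ih
  | trans _ _ ih ih' => exact .trans ih ih'
  | refFn f => exact fun _ => .ref _
  | symFn _ ih => exact fun ts => .sym (ih ts)
  | transFn _ _ ih ih' => exact fun ts => .trans (ih ts) (ih' ts)
  | ax hφ => exact .ax (Set.mem_image_of_mem _ hφ)
  | ext _ ih => exact ih
  | func _ _ ih ih' => exact .trans (ih _) (.func (.refFn _) ih')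
  | funcPred _ _ ih ih' => exact .funcPred ih ih'

/-! ### Soundness -/

/-- The formula is true in the model, where an equation between function symbols says that they
agree at all tuples of denotable arguments; off these, [Ext] gives no information. -/
def Formula.Holds (M : Model V A) : Formula V A → Prop
  | .sen φ => M.Sat φ
  | @Formula.fnEq _ _ w _ f f' => ∀ ts : ∀ j : Fin w.length, Term V A (w.get j),
      M.val (.app f ts) = M.val (.app f' ts)

theorem Derivable.holds {M : Model V A} {Γ : Set (Sentence V A)} (hM : ∀ γ ∈ Γ, M.Sat γ)
    {ψ : Formula V A} (h : Derivable Γ ψ) : ψ.Holds M := by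
  induction h with
  | ref t => exact rfl
  | sym _ ih => exact Eq.symm ih
  | trans _ _ ih ih' => exact Eq.trans ih ih'
  | refFn f => exact fun _ => rfl
  | symFn _ ih => exact fun ts => (ih ts).symm
  | transFn _ _ ih ih' => exact fun ts => (ih ts).trans (ih' ts)
  | ax hφ => exact hM _ hφ
  | ext _ ih => exact ih
  | func _ _ ih ih' => exact (ih _).trans (congrArg (M.toInterp.fn _) (funext ih'))
  | @funcPred _ _ p _ _ _ _ ih ih' =>
    exact (congrArg (· ∈ M.toInterp.pr p) (funext ih)).mp ih'

/-! ### Extensional superstructures with large layers -/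

open scoped ZFSet in
theorem superLevel_vonNeumann (o : Ordinal.{u}) (m : ℕ) :
    superLevel (V_ o) (m + 1) = V_ (o + m) := by
  induction m with
  | zero => simp [superLevel]
  | succ m ih =>
    rw [superLevel, ih, Nat.cast_succ, ← add_assoc, ZFSet.vonNeumann_add_one]
    ext x
    simp only [ZFSet.mem_union, or_iff_right_iff_imp]
    exact fun hx => ZFSet.mem_powerset.2 ((ZFSet.isTransitive_vonNeumann _).subset_of_mem hx)

theorem isExtensional_vonNeumann (o : Ordinal.{u}) : IsExtensional (ZFSet.vonNeumann o) := by
  have trans_mem : ∀ x ∈ superstructure (ZFSet.vonNeumann o), ∀ y ∈ x,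
      y ∈ superstructure (ZFSet.vonNeumann o) := by
    rintro x ⟨_ | m, hx⟩ y hy
    · exact absurd hx (ZFSet.notMem_empty x)
    · rw [superLevel_vonNeumann] at hx
      refine ⟨m + 1, ?_⟩
      rw [superLevel_vonNeumann]
      exact (ZFSet.isTransitive_vonNeumann _).subset_of_mem hx hy
  intro x hx x' hx' h
  ext y
  exact ⟨fun hy => (h y (trans_mem x hx y hy)).1 hy, fun hy => (h y (trans_mem x' hx' y hy)).2 hy⟩

open scoped ZFSet in
/-- By ranks: adding `s` back to `V_ o \ {s} ∈ V_ o` would give a set of rank less than `o`. -/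
theorem vonNeumann_diff_singleton_notMem {o : Ordinal.{u}} {s : ZFSet.{u}}
    (hs : Order.succ s.rank < o) : V_ o \ {s} ∉ V_ o := by
  intro hmem
  have hsub : V_ o ⊆ insert s (V_ o \ {s}) := by
    intro y hy
    by_cases h : y = s <;> simp [h, hy]
  have hle := ZFSet.rank_mono hsub
  rw [ZFSet.rank_vonNeumann, ZFSet.rank_insert] at hle
  exact hle.not_gt (max_lt hs (ZFSet.mem_vonNeumann.1 hmem))

/-- A set with an extensional superstructure all of whose layers are at least as large as `α`. -/
theorem exists_isExtensional_forall_injective_layer (α : Type u) :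
    ∃ S : ZFSet.{u}, IsExtensional S ∧
      ∀ i, 1 ≤ i → ∃ f : α → Layer S i, Function.Injective f := by
  let r : α → α → Prop := WellOrderingRel
  let g : α → ZFSet.{u} := fun a => (Ordinal.typein r a).toZFSet
  have g_inj : Function.Injective g :=
    Ordinal.toZFSet_injective.comp (Ordinal.typein_injective r)
  -- The summand `ω` keeps also the successors of the ranks of the `g a` strictly below `o`.
  let o : Ordinal.{u} := Ordinal.type r + Ordinal.omega0
  have rank_lt : ∀ a, Order.succ (g a).rank < o := fun a => by
    rw [Ordinal.rank_toZFSet]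
    refine (Order.succ_le_of_lt (Ordinal.typein_lt_type r a)).trans_lt ?_
    exact lt_add_of_pos_right _ Ordinal.omega0_pos
  refine ⟨ZFSet.vonNeumann o, isExtensional_vonNeumann o, ?_⟩
  have mem : ∀ a (m : ℕ), g a ∈ ZFSet.vonNeumann (o + m) := fun a m =>
    ZFSet.mem_vonNeumann.2
      (((Order.le_succ _).trans_lt (rank_lt a)).trans_le (le_self_add))
  rintro (_ | _ | m) hi
  · omega
  · refine ⟨fun a => ⟨g a, ?_⟩, fun a b hab => g_inj (congrArg Subtype.val hab)⟩
    simpa [superLevel] using mem a 0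
  · refine ⟨fun a => ⟨ZFSet.vonNeumann (o + m) \ {g a}, ?_⟩, fun a b hab => g_inj ?_⟩
    · rw [ZFSet.mem_sdiff, Nat.add_sub_cancel, superLevel_vonNeumann, superLevel_vonNeumann,
        Nat.cast_succ, ← add_assoc, ZFSet.vonNeumann_add_one, ZFSet.mem_powerset]
      exact ⟨fun y hy => (ZFSet.mem_sdiff.1 hy).1,
        vonNeumann_diff_singleton_notMem ((rank_lt a).trans_le le_self_add)⟩
    · -- `g a` is the only element missing from `V_ (o + m) \ {g a}`.
      by_contra hne
      have h : g a ∈ ZFSet.vonNeumann (o + m) \ {g b} :=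
        ZFSet.mem_sdiff.2 ⟨mem a m, fun h => hne (ZFSet.mem_singleton.1 h)⟩
      have heq : ZFSet.vonNeumann (o + m) \ {g a} = ZFSet.vonNeumann (o + m) \ {g b} :=
        congrArg Subtype.val hab
      rw [← heq] at h
      exact (ZFSet.mem_sdiff.1 h).2 (ZFSet.mem_singleton.2 rfl)

/-! ### The model of coded terms, and completeness -/

theorem Term.one_le_order {i : ℕ} (t : Term V A i) : 1 ≤ i := by
  cases t with
  | var x => exact x.2.1
  | cst c => exact (A.bound_C c).1
  | app f ts => exact (A.bound_F f).1.1

/-- Provable equality of terms of order `i`. -/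
def derivableSetoid (Γ : Set (Sentence V A)) (i : ℕ) : Setoid (Term V A i) where
  r t t' := Derivable Γ (.eq t t')
  iseqv := ⟨fun t => .ref t, fun h => .sym h, fun h h' => .trans h h'⟩

/-- A coding of the terms modulo provable equality as objects of the superstructure over `S`. -/
structure TermCoding (Γ : Set (Sentence V A)) (S : ZFSet.{u}) where
  code : ∀ {i}, Term V A i → Layer S i
  code_eq_iff : ∀ {i} (t t' : Term V A i), code t = code t' ↔ Derivable Γ (.eq t t')
  /-- A default value, for the function symbols whose result order has no terms. -/
  default : ∀ i, 1 ≤ i → Layer S i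

theorem exists_termCoding (Γ : Set (Sentence V A)) :
    ∃ S : ZFSet.{u}, IsExtensional S ∧ Nonempty (TermCoding Γ S) := by
  -- The extra point `none` makes the layers nonempty even in the absence of terms.
  obtain ⟨S, hS, h⟩ := exists_isExtensional_forall_injective_layer
    (Option (Σ i, Quotient (derivableSetoid Γ i)))
  choose f hf using h
  refine ⟨S, hS, ⟨⟨fun {i} t => f i t.one_le_order (some ⟨i, Quotient.mk _ t⟩), ?_,
    fun i hi => f i hi none⟩⟩⟩
  intro i t t'
  rw [(hf i _).eq_iff, Option.some_inj, Sigma.mk.injEq, heq_eq_eq, Quotient.eq]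
  exact and_iff_right rfl

open Classical in
/-- The model whose denotable objects are the codes of the terms, with function symbols acting on
codes as they act on terms and predicates true of the codes of which `Γ` proves them. -/
noncomputable def codedModel {Γ : Set (Sentence V A)} {S : ZFSet.{u}} (hS : IsExtensional S)
    (c : TermCoding Γ S) : Model V A where
  toInterp :=
    { S := S
      cst := fun k => c.code (.cst k)
      fn := fun {w i} f a =>
        if h : ∃ ts : ∀ j : Fin w.length, Term V A (w.get j), (fun j => c.code (ts j)) = a then
          c.code (.app f h.choose)
        else c.default i (A.bound_F f).1.1
      pr := fun p => {a | ∃ ts, (fun j => c.code (ts j)) = a ∧ Derivable Γ (.sen (.pred p ts))} }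
  ext := hS
  asg := fun x => c.code (.var x)

theorem codedModel_val {Γ : Set (Sentence V A)} {S : ZFSet.{u}} (hS : IsExtensional S)
    (c : TermCoding Γ S) {i : ℕ} (t : Term V A i) : (codedModel hS c).val t = c.code t := by
  induction t with
  | var x => rfl
  | cst k => rfl
  | @app w i f ts ih =>
    have h : ∃ ts' : ∀ j : Fin w.length, Term V A (w.get j),
        (fun j => c.code (ts' j)) = fun j => c.code (ts j) := ⟨ts, rfl⟩
    have hval : (codedModel hS c).val (.app f ts) = c.code (.app f h.choose) :=
      (congrArg ((codedModel hS c).toInterp.fn f) (funext ih)).trans (dif_pos h)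
    refine hval.trans ((c.code_eq_iff _ _).2 ?_)
    exact .func (.refFn f) fun j => (c.code_eq_iff _ _).1 (congrFun h.choose_spec j)

theorem codedModel_sat {Γ : Set (Sentence V A)} {S : ZFSet.{u}} (hS : IsExtensional S)
    (c : TermCoding Γ S) (φ : Sentence V A) :
    (codedModel hS c).Sat φ ↔ Derivable Γ (.sen φ) := by
  cases φ with
  | eq t t' =>
    simp only [Model.Sat, codedModel_val]
    exact c.code_eq_iff t t'
  | pred p ts =>
    simp only [Model.Sat, codedModel_val]
    constructor
    · rintro ⟨ts', hts, h⟩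
      exact .funcPred (fun j => (c.code_eq_iff _ _).1 (congrFun hts j)) h
    · exact fun h => ⟨ts, rfl, h⟩

theorem derivable_of_semConseq {Γ : Set (Sentence V A)} {φ : Sentence V A}
    (h : SemConseq (Model.Sat (V := V) (A := A)) Γ φ) : Derivable Γ (.sen φ) := by
  obtain ⟨S, hS, ⟨c⟩⟩ := exists_termCoding Γ
  exact (codedModel_sat hS c φ).1 (h _ fun γ hγ => (codedModel_sat hS c γ).2 (.ax hγ))

end HOEq

theorem mainTheorem3 (V : ℕ → Type u) (K : ObjectProperty HOEq.Signature.{u}) :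
    IsInstitution (K.ι ⋙ HOEq.Sen V) (K.ι.op ⋙ HOEq.Mod V) (fun A => HOEq.Sat V A.obj) ∧
    IsEntailmentSystem (K.ι ⋙ HOEq.Sen V) (fun A => HOEq.Ent V A.obj) ∧
    IsCompleteLogic (K.ι ⋙ HOEq.Sen V) (K.ι.op ⋙ HOEq.Mod V)
      (fun A => HOEq.Ent V A.obj) (fun A => HOEq.Sat V A.obj) := by
  have institution : IsInstitution (K.ι ⋙ HOEq.Sen V) (K.ι.op ⋙ HOEq.Mod V)
      (fun A => HOEq.Sat V A.obj) :=
    ⟨fun σ φ M => HOEq.Model.sat_map σ.hom M φ⟩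
  have entailment : IsEntailmentSystem (K.ι ⋙ HOEq.Sen V) (fun A => HOEq.Ent V A.obj) :=
    { refl := fun _ _ => .ax rfl
      mono := fun _ _ _ _ h hΓ => HOEq.Derivable.mono hΓ h
      trans := fun _ _ _ _ hΔ h => HOEq.Derivable.cut hΔ h
      translation := fun σ _ _ h => HOEq.Derivable.translates σ.hom h }
  exact ⟨institution, entailment,
    ⟨entailment, institution, fun _ _ _ h _ hM => HOEq.Derivable.holds hM h⟩,
    fun _ _ _ h => HOEq.derivable_of_semConseq h⟩
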